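/- Let $\mathcal{X}$ be a set, $\mathcal{Y}=\{+1,-1\}$, let $\mathcal{H}\subseteq\mathcal{Y}^{\mathcal{X}}$ be a non-empty hypothesis class, let $n\ge 0$ be an integer and let $T=(x_1,\dots,x_n)\in\mathcal{X}^n$ be a sample (repetitions allowed). Write $\mathcal{H}|_T=\{(h(x_1),\dots,h(x_n)):h\in\mathcal{H}\}\subseteq\mathcal{Y}^n$. The agnostic one-inclusion graph has vertex set $V=\mathcal{Y}^n$ and an undirected edge between $u$ and $v$ whenever $\|u-v\|_0=1$, where $\|u-v\|_0=|\{i:u_i\ne v_i\}|$ is the Hamming distance. For non-empty $U\subseteq V$ let $E(U,U)$ be the set of edges with both endpoints in $U$ and define the discounted edge density $$\Phi_{\mathrm{discounted}}(U)=\frac{|E(U,U)|-\sum_{u\in U}\min_{v\in\mathcal{H}|_T}\|u-v\|_0}{|U|}.$$ Let $$\hat{\Re}_T(\mathcal{H}|_T)=\frac1n\,\mathbb{E}_{\sigma}\Big[\sup_{h\in\mathcal{H}|_T}\sum_{i=1}^n\sigma_i h_i\Big],\qquad \sigma \text{ uniform on } \{+1,-1\}^n,$$ be the empirical Rademacher complexity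 (read as $0$ when $n=0$). Then $$\Phi_{\mathrm{discounted}}(V)=\frac n2\cdot\hat{\Re}_T(\mathcal{H}|_T).$$ Moreover, if the VC dimension $\operatorname{VC}(\mathcal{H})$ (the supremum of the sizes of finite sets $S\subseteq\mathcal{X}$ on which $\mathcal{H}$ realizes all $2^{|S|}$ labelings) is finite, then $$\Phi_{\mathrm{discounted}}(V)\le 16\sqrt{n\cdot\operatorname{VC}(\mathcal{H})}.$$ -/

import Mathlib

namespace AgnosticOIG

open scoped BigOperators

/-- A labeling of `n` data points. The label set `{+1, -1}` is the group of units of `ℤ`,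
whose only elements are `1` and `-1`. -/
abbrev Labeling (n : ℕ) : Type := Fin n → ℤˣ

/-- The restriction `H|_T` of a hypothesis class to a sample `T ∈ X^n`. -/
def restrict {X : Type*} (H : Set (X → ℤˣ)) {n : ℕ} (T : Fin n → X) : Set (Labeling n) :=
  {v | ∃ h ∈ H, v = fun i => h (T i)}

/-- `H` shatters the finite set `S` if every labeling of `S` is realized by some `h ∈ H`. -/
def Shatters {X : Type*} (H : Set (X → ℤˣ)) (S : Finset X) : Prop :=
  ∀ y : S → ℤˣ, ∃ h ∈ H, ∀ x : S, h x = y x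

/-- The VC dimension: the supremum (possibly infinite) of the sizes of shattered finite sets. -/
noncomputable def vcDim {X : Type*} (H : Set (X → ℤˣ)) : ℕ∞ :=
  ⨆ (S : Finset X) (_ : Shatters H S), (S.card : ℕ∞)

/-- The agnostic one-inclusion graph on all labelings of `n` points: two labelings are adjacent
iff their Hamming distance is one. -/
def graph (n : ℕ) : SimpleGraph (Labeling n) where
  Adj u v := hammingDist u v = 1
  symm := ⟨fun u v h => by rwa [hammingDist_comm]⟩
  loopless := ⟨fun u h => by simp at h⟩

/-- The (undirected) edges of the agnostic one-inclusion graph with both endpoints in `U`. -/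
def edgesWithin {n : ℕ} (U : Finset (Labeling n)) : Set (Sym2 (Labeling n)) :=
  {e | e ∈ (graph n).edgeSet ∧ ∀ v ∈ e, v ∈ U}

/-- The credit of a vertex `u`: the least Hamming distance from `u` to a labeling in `A`
(a minimum whenever `A` is nonempty). -/
noncomputable def credit {n : ℕ} (A : Set (Labeling n)) (u : Labeling n) : ℕ :=
  sInf ((fun v => hammingDist u v) '' A)

/-- The discounted edge density of a set `U` of vertices, with respect to the set `A` of
realizable labelings. -/
noncomputable def discountedDensity {n : ℕ} (A : Set (Labeling n)) (U : Finset (Labeling n)) : ℝ :=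
  (((edgesWithin U).ncard : ℝ) - ∑ u ∈ U, (credit A u : ℝ)) / (U.card : ℝ)

/-- The empirical Rademacher complexity of a set `A` of labelings of `n` points; `Finset.expect`
is the average over the uniformly distributed sign vector `σ`. -/
noncomputable def rademacher {n : ℕ} (A : Set (Labeling n)) : ℝ :=
  (1 / (n : ℝ)) * Finset.expect Finset.univ (fun σ : Labeling n =>
    ⨆ h : A, ∑ i : Fin n, ((σ i : ℤ) : ℝ) * (((h : Labeling n) i : ℤ) : ℝ))

end AgnosticOIG

namespace AgnosticOIG

open Finset

/-! Since `⟨σ, h⟩ = n - 2 d(σ, h)`, the supremum over realizable `h` is `n` minus twice the credit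
of `σ`. The cube is `n`-regular, so it has `n / 2` edges per vertex, and averaging over `σ` makes
the density half the width. The width is bounded by chaining without a logarithmic factor. Nets at
scales `4⁻ʲ n` are linked by the maximal inequality (`width_le_width_add`), and their
log-cardinality is `O(d (j + 1))` by subsampling and Sauer-Shelah (`log_card_le_of_separated`). The
geometric series gives width at most `24 √(n d)`, hence density at most `12 √(n d)`. -/

/-- The Rademacher width of a set of labelings: `n` times its Rademacher complexity. -/
noncomputable def width {n : ℕ} (A : Set (Labeling n)) : ℝ :=
  Finset.expect Finset.univ (fun σ : Labeling n =>
    ⨆ h : A, ∑ i : Fin n, ((σ i : ℤ) : ℝ) * (((h : Labeling n) i : ℤ) : ℝ))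

/-! ### The density of the cube -/

theorem sum_mul_eq_sub_hammingDist {n : ℕ} (σ h : Labeling n) :
    ∑ i, ((σ i : ℤ) : ℝ) * ((h i : ℤ) : ℝ) = n - 2 * (hammingDist σ h : ℝ) := by
  have key : ∀ i, ((σ i : ℤ) : ℝ) * ((h i : ℤ) : ℝ) = 1 - 2 * (if σ i ≠ h i then 1 else 0) := by
    intro i
    rcases Int.units_eq_one_or (σ i) with h1 | h1 <;>
      rcases Int.units_eq_one_or (h i) with h2 | h2 <;> rw [h1, h2] <;> norm_num
  simp_rw [key]
  rw [Finset.sum_sub_distrib, ← Finset.mul_sum, Finset.sum_boole]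
  simp [hammingDist]

theorem iSup_sum_mul_eq_sub_credit {n : ℕ} {A : Set (Labeling n)} (hA : A.Nonempty)
    (σ : Labeling n) :
    ⨆ h : A, ∑ i, ((σ i : ℤ) : ℝ) * (((h : Labeling n) i : ℤ) : ℝ) =
      n - 2 * (credit A σ : ℝ) := by
  have := hA.to_subtype
  simp_rw [sum_mul_eq_sub_hammingDist]
  obtain ⟨v, hv, hv'⟩ := Nat.sInf_mem (hA.image fun v => hammingDist σ v)
  apply le_antisymm
  · refine ciSup_le fun h => ?_
    have : credit A σ ≤ hammingDist σ h := Nat.sInf_le ⟨h, h.2, rfl⟩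
    have : (credit A σ : ℝ) ≤ hammingDist σ (h : Labeling n) := by exact_mod_cast this
    linarith
  · have : credit A σ = hammingDist σ v := hv'.symm
    rw [this]
    exact le_ciSup (f := fun h : A => (n : ℝ) - 2 * (hammingDist σ (h : Labeling n) : ℝ))
      (Set.finite_range _).bddAbove ⟨v, hv⟩

theorem card_hammingDist_eq_one {n : ℕ} (u : Labeling n) :
    #{v : Labeling n | hammingDist u v = 1} = n := by
  have hne : ∀ x : ℤˣ, -x ≠ x := by decide
  have : ({v : Labeling n | hammingDist u v = 1} : Finset (Labeling n)) =
      univ.image fun i => Function.update u i (-u i) := by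
    ext v
    simp only [mem_filter, mem_univ, true_and, mem_image, hammingDist, Finset.card_eq_one]
    constructor
    · rintro ⟨i, hi⟩
      refine ⟨i, funext fun j => ?_⟩
      have hj := Finset.ext_iff.1 hi j
      simp only [mem_filter, mem_univ, true_and, mem_singleton] at hj
      by_cases hji : j = i
      · subst hji
        rw [Function.update_self]
        have := hj.2 rfl
        rcases Int.units_eq_one_or (u j) with h1 | h1 <;>
          rcases Int.units_eq_one_or (v j) with h2 | h2 <;> simp_all
      · rw [Function.update_of_ne hji]
        by_contra h
        exact hji (hj.1 h)
    · rintro ⟨i, rfl⟩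
      refine ⟨i, ?_⟩
      ext j
      by_cases hji : j = i
      · subst hji
        simp [(hne (u j)).symm]
      · simp [hji]
  rw [this, Finset.card_image_of_injective, card_univ, Fintype.card_fin]
  intro i j hij
  by_contra hne'
  have := congrFun hij i
  simp only [Function.update_self, Function.update_of_ne hne'] at this
  exact hne _ this

theorem two_mul_ncard_edgesWithin_univ (n : ℕ) :
    2 * (edgesWithin (univ : Finset (Labeling n))).ncard =
      n * Fintype.card (Labeling n) := by
  classical
  have h1 : edgesWithin (univ : Finset (Labeling n)) = (graph n).edgeSet := by
    ext e; simp [edgesWithin]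
  have h2 : ∀ u, (graph n).degree u = n := by
    intro u
    rw [← SimpleGraph.card_neighborFinset_eq_degree]
    convert card_hammingDist_eq_one u using 2
    ext v
    simp only [SimpleGraph.mem_neighborFinset, mem_filter, mem_univ, true_and]
    rfl
  rw [h1, ← SimpleGraph.coe_edgeFinset, Set.ncard_coe_finset,
    ← SimpleGraph.sum_degrees_eq_twice_card_edges]
  simp [h2, mul_comm]

theorem discountedDensity_univ {n : ℕ} {A : Set (Labeling n)} (hA : A.Nonempty) :
    discountedDensity A univ = width A / 2 := by
  have hE : 2 * ((edgesWithin (univ : Finset (Labeling n))).ncard : ℝ) =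
      n * Fintype.card (Labeling n) := by exact_mod_cast two_mul_ncard_edgesWithin_univ n
  have hc : (0 : ℝ) < Fintype.card (Labeling n) := by exact_mod_cast Fintype.card_pos
  rw [discountedDensity, width]
  simp_rw [iSup_sum_mul_eq_sub_credit hA]
  rw [Fintype.expect_eq_sum_div_card, Finset.sum_sub_distrib, ← Finset.mul_sum, Finset.card_univ,
    Finset.sum_const, Finset.card_univ, nsmul_eq_mul]
  field_simp
  linarith

theorem mul_rademacher {n : ℕ} (A : Set (Labeling n)) (hA : A.Nonempty) :
    (n : ℝ) / 2 * rademacher A = width A / 2 := by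
  -- At `n = 0` the factor `1 / n` is `0`, and the width averages empty sums.
  rcases Nat.eq_zero_or_pos n with rfl | hn
  · have := hA.to_subtype
    simp [width]
  · have : (0 : ℝ) < n := by exact_mod_cast hn
    rw [rademacher, width]
    field_simp

/-! ### The maximal inequality for finite families of Rademacher sums -/

/-- The signs are independent, so the average factors into `cosh (a i) ≤ exp (a i ^ 2 / 2)`. -/
theorem expect_exp_sum_le {n : ℕ} (a : Fin n → ℝ) {r : ℝ} (ha : ∑ i, a i ^ 2 ≤ r) :
    Finset.expect univ (fun σ : Labeling n => Real.exp (∑ i, ((σ i : ℤ) : ℝ) * a i)) ≤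
      Real.exp (r / 2) := by
  have h1 : ∑ σ : Labeling n, Real.exp (∑ i, ((σ i : ℤ) : ℝ) * a i) =
      ∏ i, (2 * Real.cosh (a i)) := by
    simp_rw [Real.exp_sum]
    rw [← Fintype.prod_sum (fun (i : Fin n) (s : ℤˣ) => Real.exp (((s : ℤ) : ℝ) * a i))]
    refine Finset.prod_congr rfl fun i _ => ?_
    rw [Real.cosh_eq, show (univ : Finset ℤˣ) = {1, -1} from rfl, Finset.sum_pair (by decide)]
    simp
    ring
  rw [Fintype.expect_eq_sum_div_card, h1, Finset.prod_mul_distrib]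
  have h2 : ((Fintype.card (Labeling n) : ℕ) : ℝ) = ∏ _i : Fin n, (2 : ℝ) := by
    simp [Fintype.card_units_int]
  rw [h2, mul_div_cancel_left₀ _ (by simp)]
  calc ∏ i, Real.cosh (a i) ≤ ∏ i, Real.exp (a i ^ 2 / 2) :=
        Finset.prod_le_prod (fun i _ => (Real.cosh_pos _).le)
          fun i _ => Real.cosh_le_exp_half_sq _
    _ = Real.exp ((∑ i, a i ^ 2) / 2) := by rw [← Real.exp_sum, Finset.sum_div]
    _ ≤ Real.exp (r / 2) := by gcongr

theorem expect_iSup_sum_le {n : ℕ} {ι : Type*} [Fintype ι] [Nonempty ι] (a : ι → Fin n → ℝ)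
    {r L : ℝ} (hr : 0 < r) (hL : 0 < L) (ha : ∀ h, ∑ i, a h i ^ 2 ≤ r)
    (hι : Real.log (Fintype.card ι) ≤ L) :
    Finset.expect univ (fun σ : Labeling n => ⨆ h, ∑ i, ((σ i : ℤ) : ℝ) * a h i) ≤
      Real.sqrt (2 * r * L) := by
  set s := Real.sqrt (2 * r * L) with hs
  have hs0 : 0 < s := by positivity
  have hss : s * s = 2 * r * L := Real.mul_self_sqrt (by positivity)
  -- This `l` minimizes `L / l + l * r / 2`, with minimum `s`.
  set l := s / r with hl
  have hl0 : 0 < l := by positivity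
  set S : Labeling n → ℝ := fun σ => ⨆ h, ∑ i, ((σ i : ℤ) : ℝ) * a h i with hS
  have hc : (0 : ℝ) < Fintype.card (Labeling n) := by exact_mod_cast Fintype.card_pos
  have hι0 : (0 : ℝ) < Fintype.card ι := by exact_mod_cast Fintype.card_pos
  -- The tangent bound `1 + x ≤ exp x` at `x = l * (S σ - s)` replaces Jensen; the maximum of
  -- exponentials is then bounded by their sum.
  have hpt : ∀ σ, l * S σ + (1 - l * s) ≤
      ∑ h, Real.exp (∑ i, ((σ i : ℤ) : ℝ) * (l * a h i)) * Real.exp (-(l * s)) := by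
    intro σ
    obtain ⟨h, hh⟩ := exists_eq_ciSup_of_finite (f := fun h => ∑ i, ((σ i : ℤ) : ℝ) * a h i)
    have h1 : l * S σ = ∑ i, ((σ i : ℤ) : ℝ) * (l * a h i) := by
      rw [hS]
      simp only
      rw [← hh, Finset.mul_sum]
      exact Finset.sum_congr rfl fun i _ => by ring
    calc l * S σ + (1 - l * s) ≤ Real.exp (l * S σ - l * s) := by
          linarith [Real.add_one_le_exp (l * S σ - l * s)]
      _ = Real.exp (∑ i, ((σ i : ℤ) : ℝ) * (l * a h i)) * Real.exp (-(l * s)) := by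
          rw [← Real.exp_add, h1, sub_eq_add_neg]
      _ ≤ _ := Finset.single_le_sum
          (f := fun h => Real.exp (∑ i, ((σ i : ℤ) : ℝ) * (l * a h i)) * Real.exp (-(l * s)))
          (fun _ _ => by positivity) (mem_univ h)
  have hsum := Finset.expect_le_expect (s := univ) fun σ _ => hpt σ
  rw [Finset.expect_add_distrib, ← Finset.mul_expect, Fintype.expect_const,
    Finset.expect_sum_comm] at hsum
  simp_rw [← Finset.expect_mul] at hsum
  have hle : ∑ h, Finset.expect univ (fun σ : Labeling n =>
      Real.exp (∑ i, ((σ i : ℤ) : ℝ) * (l * a h i))) * Real.exp (-(l * s)) ≤ 1 := by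
    calc _ ≤ ∑ _h : ι, Real.exp (l ^ 2 * r / 2) * Real.exp (-(l * s)) := by
          refine Finset.sum_le_sum fun h _ => ?_
          gcongr
          refine expect_exp_sum_le _ ?_
          simp_rw [mul_pow, ← Finset.mul_sum]
          gcongr
          exact ha h
      _ = Real.exp (Real.log (Fintype.card ι) + (l ^ 2 * r / 2 + -(l * s))) := by
          rw [Real.exp_add, Real.exp_log hι0, Real.exp_add]
          simp
      _ ≤ 1 := by
          rw [Real.exp_le_one_iff]
          have : l ^ 2 * r / 2 + -(l * s) = -L := by
            rw [hl]
            field_simp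
            nlinarith
          linarith
  have : l * Finset.expect univ S ≤ l * s := by linarith
  exact le_of_mul_le_mul_left this hl0

/-- One chaining link: `h - π h` has entries `0` or `±2`, so its squared norm is `4 d(h, π h) ≤ 4
k`. -/
theorem width_le_width_add {n : ℕ} {A P : Finset (Labeling n)} (hA : A.Nonempty) {k L : ℝ}
    (hk : 0 < k) (hL : 0 < L) (hcov : ∀ h ∈ A, ∃ p ∈ P, (hammingDist h p : ℝ) ≤ k)
    (hcard : Real.log #A ≤ L) :
    width (A : Set (Labeling n)) ≤ width (P : Set (Labeling n)) + Real.sqrt (8 * k * L) := by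
  have : Nonempty (A : Set (Labeling n)) := hA.to_subtype
  choose! π hπ hd using hcov
  have hM := expect_iSup_sum_le (n := n) (ι := (A : Set (Labeling n)))
    (a := fun h i => (((h : Labeling n) i : ℤ) : ℝ) - ((π h i : ℤ) : ℝ))
    (r := 4 * k) (L := L) (by positivity) hL ?_ ?_
  · rw [show 8 * k * L = 2 * (4 * k) * L by ring]
    refine le_trans ?_ (add_le_add_right hM _)
    rw [width, width, ← Finset.expect_add_distrib]
    refine Finset.expect_le_expect fun σ _ => ciSup_le fun h => ?_
    have h1 := le_ciSup (f := fun h : (P : Set (Labeling n)) =>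
      ∑ i, ((σ i : ℤ) : ℝ) * (((h : Labeling n) i : ℤ) : ℝ)) (Set.finite_range _).bddAbove
      ⟨π h, hπ h h.2⟩
    have h2 := le_ciSup (f := fun h : (A : Set (Labeling n)) =>
      ∑ i, ((σ i : ℤ) : ℝ) * ((((h : Labeling n) i : ℤ) : ℝ) - ((π h i : ℤ) : ℝ)))
      (Set.finite_range _).bddAbove h
    refine le_trans (le_of_eq ?_) (add_le_add h1 h2)
    rw [← Finset.sum_add_distrib]
    exact Finset.sum_congr rfl fun i _ => by ring
  · intro h
    have key : ∀ i, ((((h : Labeling n) i : ℤ) : ℝ) - ((π h i : ℤ) : ℝ)) ^ 2 =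
        4 * (if (h : Labeling n) i ≠ π h i then 1 else 0) := by
      intro i
      rcases Int.units_eq_one_or ((h : Labeling n) i) with h1 | h1 <;>
        rcases Int.units_eq_one_or (π h i) with h2 | h2 <;> rw [h1, h2] <;> norm_num
    simp_rw [key]
    rw [← Finset.mul_sum, Finset.sum_boole]
    have := hd h h.2
    rw [hammingDist] at this
    linarith
  · simpa using hcard

theorem width_singleton {n : ℕ} (p : Labeling n) : width ({p} : Set (Labeling n)) = 0 := by
  have h2 : ∀ i, ∑ σ : Labeling n, ((σ i : ℤ) : ℝ) = 0 := by
    intro i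
    have : ∑ σ : Labeling n, ((σ i : ℤ) : ℝ) = ∑ σ : Labeling n, -((σ i : ℤ) : ℝ) :=
      Fintype.sum_equiv (Equiv.neg _) _ _ fun σ => by simp
    rw [Finset.sum_neg_distrib] at this
    linarith
  rw [width, Fintype.expect_eq_sum_div_card]
  simp only [ciSup_unique, Set.default_coe_singleton]
  rw [Finset.sum_comm]
  simp [← Finset.sum_mul, h2]

/-! ### Traces and packings of classes of bounded VC dimension -/

/-- Sauer-Shelah in generating-function form: `B` has at most as many elements as it shatters index
sets `s`, each with `t ^ d ≤ t ^ #s`, and `t ^ #s` summed over all subsets is `(1 + t) ^ m`. -/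
theorem card_mul_pow_le {X : Type*} {H : Set (X → ℤˣ)} {d : ℕ}
    (hd : ∀ S : Finset X, Shatters H S → #S ≤ d) {m : ℕ} (T : Fin m → X)
    {B : Finset (Labeling m)} (hB : (B : Set (Labeling m)) ⊆ restrict H T) {t : ℝ}
    (ht0 : 0 < t) (ht1 : t ≤ 1) : (#B : ℝ) * t ^ d ≤ (1 + t) ^ m := by
  classical
  let φ : Labeling m → Finset (Fin m) := fun v => {i | v i = 1}
  have hφ : Function.Injective φ := by
    intro u v huv
    ext i : 1
    have := Finset.ext_iff.1 huv i
    simp only [φ, mem_filter, mem_univ, true_and] at this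
    rcases Int.units_eq_one_or (u i) with h1 | h1 <;>
      rcases Int.units_eq_one_or (v i) with h2 | h2 <;> simp_all
  have hcard : #B ≤ #(B.image φ).shatterer := by
    rw [← Finset.card_image_of_injective B hφ]
    exact Finset.card_le_card_shatterer _
  have hsh : ∀ s ∈ (B.image φ).shatterer, #s ≤ d := by
    intro s hs
    rw [Finset.mem_shatterer] at hs
    have hreal : ∀ w ⊆ s, ∃ h ∈ H, ∀ i ∈ s, h (T i) = 1 ↔ i ∈ w := by
      intro w hw
      obtain ⟨u, hu, huw⟩ := hs hw
      obtain ⟨v, hv, rfl⟩ := Finset.mem_image.1 hu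
      obtain ⟨h, hh, rfl⟩ := hB hv
      refine ⟨h, hh, fun i hi => ?_⟩
      rw [← huw]
      simp [φ, hi]
    -- Repeated sample points get equal labels, so a shattered index set contains no repetition.
    have hinj : Set.InjOn T s := by
      intro i hi j hj hij
      obtain ⟨h, -, hw⟩ := hreal {i} (by simpa using hi)
      have h1 := (hw i hi).2 (by simp)
      have h2 := (hw j hj).1 (hij ▸ h1)
      exact (Finset.mem_singleton.1 h2).symm
    rw [← Finset.card_image_of_injOn hinj]
    refine hd _ fun y => ?_
    obtain ⟨h, hh, hw⟩ := hreal {i ∈ s | ∃ hx : T i ∈ s.image T, y ⟨T i, hx⟩ = 1}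
      (Finset.filter_subset _ _)
    refine ⟨h, hh, ?_⟩
    rintro ⟨x, hx⟩
    obtain ⟨i, hi, rfl⟩ := Finset.mem_image.1 hx
    have := hw i hi
    simp only [mem_filter, hi, true_and, hx, exists_true_left] at this
    rcases Int.units_eq_one_or (h (T i)) with h1 | h1 <;>
      rcases Int.units_eq_one_or (y ⟨T i, hx⟩) with h2 | h2 <;> simp_all
  calc (#B : ℝ) * t ^ d ≤ #(B.image φ).shatterer * t ^ d := by gcongr
    _ = ∑ _s ∈ (B.image φ).shatterer, t ^ d := by simp
    _ ≤ ∑ s ∈ (B.image φ).shatterer, t ^ #s :=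
        Finset.sum_le_sum fun s hs => pow_le_pow_of_le_one ht0.le ht1 (hsh s hs)
    _ ≤ ∑ s ∈ (univ : Finset (Fin m)).powerset, t ^ #s :=
        Finset.sum_le_sum_of_subset_of_nonneg (fun s _ => by simp) fun _ _ _ => by positivity
    _ = (1 + t) ^ m := by
        have := Finset.sum_pow_mul_eq_add_pow t 1 (univ : Finset (Fin m))
        simpa [add_comm] using this

theorem card_comp_eq {n m : ℕ} (u v : Labeling n) :
    #{f : Fin m → Fin n | u ∘ f = v ∘ f} = (n - hammingDist u v) ^ m := by
  have h1 : ({f : Fin m → Fin n | u ∘ f = v ∘ f} : Finset (Fin m → Fin n)) =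
      Fintype.piFinset fun _ => ({i | u i = v i} : Finset (Fin n)) := by
    ext f
    simp [funext_iff]
  have h2 : #{i | u i = v i} + hammingDist u v = n := by
    rw [hammingDist]
    simpa using Finset.card_filter_add_card_filter_not (s := univ) fun i => u i = v i
  rw [h1, Fintype.card_piFinset_const]
  congr 1
  omega

/-- Union bound over a random subsample `f`: a given pair becomes identified with probability at
most `exp (-ε m)`, and there are fewer than `#B ^ 2` pairs. -/
theorem exists_injOn_comp {n m : ℕ} (hn : 0 < n) {B : Finset (Labeling n)} {ε : ℝ}
    (hB : B.Nonempty) (hsep : ∀ u ∈ B, ∀ v ∈ B, u ≠ v → ε * n < hammingDist u v)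
    (hm : 2 * Real.log #B < ε * m) :
    ∃ f : Fin m → Fin n, Set.InjOn (fun u : Labeling n => u ∘ f) B := by
  classical
  by_contra! hcon
  have hn' : (0 : ℝ) < n := by exact_mod_cast hn
  have hB' : (0 : ℝ) < #B := by exact_mod_cast hB.card_pos
  have hcov : (univ : Finset (Fin m → Fin n)) ⊆
      B.offDiag.biUnion fun p => {f : Fin m → Fin n | p.1 ∘ f = p.2 ∘ f} := by
    intro f _
    have := hcon f
    simp only [Set.InjOn, not_forall] at this
    obtain ⟨u, hu, v, hv, huv, hne⟩ := this
    simp only [mem_biUnion, mem_offDiag, mem_filter, mem_univ, true_and]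
    exact ⟨(u, v), ⟨hu, hv, hne⟩, huv⟩
  have h1 := (Finset.card_le_card hcov).trans Finset.card_biUnion_le
  simp_rw [card_comp_eq] at h1
  have h2 : ((n : ℝ)) ^ m ≤ ∑ p ∈ B.offDiag, ((n - hammingDist p.1 p.2 : ℕ) : ℝ) ^ m := by
    have h1' : n ^ m ≤ ∑ p ∈ B.offDiag, (n - hammingDist p.1 p.2) ^ m := by simpa using h1
    exact_mod_cast h1'
  have h3 : ∀ p ∈ B.offDiag, ((n - hammingDist p.1 p.2 : ℕ) : ℝ) ^ m ≤
      n ^ m * Real.exp (-(ε * m)) := by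
    intro p hp
    rw [mem_offDiag] at hp
    have hs := hsep p.1 hp.1 p.2 hp.2.1 hp.2.2
    have hle : hammingDist p.1 p.2 ≤ n := by
      simpa using hammingDist_le_card_fintype (x := p.1) (y := p.2)
    have : ((n - hammingDist p.1 p.2 : ℕ) : ℝ) ≤ n * Real.exp (-ε) := by
      rw [Nat.cast_sub hle]
      nlinarith [Real.add_one_le_exp (-ε)]
    calc _ ≤ (n * Real.exp (-ε)) ^ m := by gcongr
      _ = _ := by rw [mul_pow, ← Real.exp_nat_mul]; congr 2; ring
  have h4 := h2.trans (Finset.sum_le_sum h3)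
  rw [Finset.sum_const, nsmul_eq_mul] at h4
  have h5 : (#B.offDiag : ℝ) ≤ #B * #B := by
    rw [offDiag_card]
    exact_mod_cast Nat.sub_le _ _
  have h6 : (#B : ℝ) * #B * Real.exp (-(ε * m)) < 1 := by
    have : (#B : ℝ) * #B = Real.exp (2 * Real.log #B) := by
      rw [two_mul, Real.exp_add, Real.exp_log hB']
    rw [this, ← Real.exp_add, Real.exp_lt_one_iff]
    linarith
  have h7 : (0 : ℝ) < (n : ℝ) ^ m := by positivity
  have h8 : (#B.offDiag : ℝ) * (n ^ m * Real.exp (-(ε * m))) ≤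
      #B * #B * (n ^ m * Real.exp (-(ε * m))) := by gcongr
  nlinarith

theorem log_card_le_of_separated {X : Type*} {H : Set (X → ℤˣ)} {d : ℕ}
    (hd : ∀ S : Finset X, Shatters H S → #S ≤ d) {n : ℕ} (hn : 0 < n) (T : Fin n → X)
    {B : Finset (Labeling n)} (hB : (B : Set (Labeling n)) ⊆ restrict H T) (hB0 : B.Nonempty)
    {ε : ℝ} (hε0 : 0 < ε) (hε1 : ε ≤ 1)
    (hsep : ∀ u ∈ B, ∀ v ∈ B, u ≠ v → ε * n < hammingDist u v) :
    Real.log #B ≤ 2 * d * Real.log (4 / ε) + 1 / 2 := by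
  classical
  have hB' : (0 : ℝ) < #B := by exact_mod_cast hB0.card_pos
  have hlog : 0 ≤ Real.log #B := Real.log_natCast_nonneg _
  obtain ⟨m, hm1, hm2⟩ : ∃ m : ℕ, 2 * Real.log #B < ε * m ∧ ε * m ≤ 2 * Real.log #B + ε := by
    refine ⟨⌊2 * Real.log #B / ε⌋₊ + 1, ?_, ?_⟩
    · have := Nat.lt_floor_add_one (2 * Real.log #B / ε)
      rw [div_lt_iff₀ hε0] at this
      push_cast
      linarith
    · have := Nat.floor_le (a := 2 * Real.log #B / ε) (by positivity)
      rw [le_div_iff₀ hε0] at this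
      push_cast
      linarith
  obtain ⟨f, hf⟩ := exists_injOn_comp hn hB0 hsep hm1
  have hsub : ((B.image fun u : Labeling n => u ∘ f : Finset (Labeling m)) :
      Set (Labeling m)) ⊆ restrict H (T ∘ f) := by
    intro w hw
    rw [Finset.mem_coe, Finset.mem_image] at hw
    obtain ⟨u, hu, rfl⟩ := hw
    obtain ⟨h, hh, rfl⟩ := hB hu
    exact ⟨h, hh, rfl⟩
  -- With `t = ε / 4` the right side is at most `exp (ε m / 4)`, and `ε m / 4 ≤ log #B / 2 + ε / 4`,
  -- so half of `log #B` is absorbed on the left.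
  have key := card_mul_pow_le hd (T ∘ f) hsub (t := ε / 4) (by positivity) (by linarith)
  rw [Finset.card_image_of_injOn hf] at key
  have h1 : (1 + ε / 4) ^ m ≤ Real.exp (ε / 4 * m) := by
    rw [mul_comm, Real.exp_nat_mul]
    gcongr
    linarith [Real.add_one_le_exp (ε / 4)]
  have h2 := Real.log_le_log (by positivity) (key.trans h1)
  rw [Real.log_exp, Real.log_mul hB'.ne' (by positivity), Real.log_pow] at h2
  have h3 : Real.log (4 / ε) = -Real.log (ε / 4) := by rw [← Real.log_inv, inv_div]
  rw [h3]
  linarith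

/-- A separated subset of maximal size covers, since an uncovered point could be added. -/
theorem exists_separated_cover {n : ℕ} (A : Finset (Labeling n)) {k : ℝ} (hk : 0 ≤ k) :
    ∃ P ⊆ A, (∀ u ∈ P, ∀ v ∈ P, u ≠ v → k < hammingDist u v) ∧
      ∀ h ∈ A, ∃ p ∈ P, (hammingDist h p : ℝ) ≤ k := by
  classical
  obtain ⟨P, hP, hmax⟩ := Finset.exists_max_image
    (A.powerset.filter fun P => ∀ u ∈ P, ∀ v ∈ P, u ≠ v → k < hammingDist u v) Finset.card
    ⟨∅, by simp⟩
  rw [mem_filter, mem_powerset] at hP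
  refine ⟨P, hP.1, hP.2, fun h hh => ?_⟩
  by_contra! hcon
  have hnot : h ∉ P := fun hmem => by
    have := hcon h hmem
    rw [hammingDist_self] at this
    simp only [Nat.cast_zero] at this
    linarith
  have := hmax (insert h P) ?_
  · rw [Finset.card_insert_of_notMem hnot] at this
    omega
  · rw [mem_filter, mem_powerset]
    refine ⟨Finset.insert_subset hh hP.1, ?_⟩
    intro u hu v hv huv
    rw [mem_insert] at hu hv
    rcases hu with rfl | hu <;> rcases hv with rfl | hv
    · exact absurd rfl huv
    · exact hcon v hv
    · rw [hammingDist_comm]; exact hcon u hu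
    · exact hP.2 u hu v hv huv

/-! ### Chaining -/

theorem width_separated_le {X : Type*} {H : Set (X → ℤˣ)} {d : ℕ} (hd0 : 0 < d)
    (hd : ∀ S : Finset X, Shatters H S → #S ≤ d) {n : ℕ} (hn : 0 < n) (T : Fin n → X)
    {A : Finset (Labeling n)} (hA : (A : Set (Labeling n)) ⊆ restrict H T) (j : ℕ) :
    ∀ P ⊆ A, P.Nonempty →
      (∀ u ∈ P, ∀ v ∈ P, u ≠ v → (4 : ℝ)⁻¹ ^ j * n < hammingDist u v) →
      width (P : Set (Labeling n)) ≤
        -- The last factor is the partial sum of `(i + 2) * 2⁻ⁱ` over `i < j`.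
        4 * Real.sqrt (n * d) * (6 - (2 * j + 6) * (2 : ℝ)⁻¹ ^ j) := by
  induction j with
  | zero =>
    intro P _ hP hsep
    have : ∃ p, P = {p} := by
      obtain ⟨p, hp⟩ := hP
      refine ⟨p, Finset.eq_singleton_iff_unique_mem.2 ⟨hp, fun q hq => ?_⟩⟩
      by_contra hne
      have h1 := hsep q hq p hp hne
      have h2 : hammingDist q p ≤ n := by
        simpa using hammingDist_le_card_fintype (x := q) (y := p)
      have h3 : (hammingDist q p : ℝ) ≤ n := by exact_mod_cast h2
      simp only [pow_zero, one_mul] at h1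
      linarith
    obtain ⟨p, rfl⟩ := this
    simp [width_singleton]
  | succ j ih =>
    intro P hPA hP hsep
    have hn' : (0 : ℝ) < n := by exact_mod_cast hn
    have hd' : (1 : ℝ) ≤ d := by exact_mod_cast hd0
    obtain ⟨Q, hQA, hQ, hcov⟩ := exists_separated_cover A (k := (4 : ℝ)⁻¹ ^ j * n) (by positivity)
    obtain ⟨p, hp⟩ := hP
    have hQ0 : Q.Nonempty := by
      obtain ⟨q, hq, -⟩ := hcov p (hPA hp)
      exact ⟨q, hq⟩
    have hlog := log_card_le_of_separated hd hn T
      ((Finset.coe_subset.2 hPA).trans hA) ⟨p, hp⟩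
      (by positivity) (pow_le_one₀ (by norm_num) (by norm_num)) hsep
    have hlog4 : Real.log (4 / (4 : ℝ)⁻¹ ^ (j + 1)) ≤ 1.4 * (j + 2) := by
      have : (4 : ℝ) / (4 : ℝ)⁻¹ ^ (j + 1) = 2 ^ (2 * (j + 2)) := by
        rw [inv_pow, div_inv_eq_mul, pow_mul]
        norm_num
        ring
      rw [this, Real.log_pow]
      push_cast
      have := Real.log_two_lt_d9
      nlinarith [(Nat.cast_nonneg j : (0 : ℝ) ≤ j)]
    -- The linear bound is weakened to a square so that its root is explicit; `1 ≤ d` absorbs the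
    -- additive `1 / 2`.
    have hcard : Real.log #P ≤ 2 * d * (j + 2) ^ 2 := by
      refine hlog.trans ?_
      have hj : (0 : ℝ) ≤ j := Nat.cast_nonneg j
      have h1 : 2 * (d : ℝ) * Real.log (4 / (4 : ℝ)⁻¹ ^ (j + 1)) ≤ 2 * d * (1.4 * (j + 2)) := by
        gcongr
      have h2 : 1.4 * ((j : ℝ) + 2) + 1 / 4 ≤ (j + 2) ^ 2 := by nlinarith
      nlinarith
    have hstep := width_le_width_add ⟨p, hp⟩ (P := Q) (k := (4 : ℝ)⁻¹ ^ j * n)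
      (L := 2 * d * (j + 2) ^ 2) (by positivity) (by positivity)
      (fun h hh => hcov h (hPA hh)) hcard
    have hsq : Real.sqrt (8 * ((4 : ℝ)⁻¹ ^ j * n) * (2 * d * (j + 2) ^ 2)) =
        4 * Real.sqrt (n * d) * ((j + 2) * (2 : ℝ)⁻¹ ^ j) := by
      rw [show 8 * ((4 : ℝ)⁻¹ ^ j * n) * (2 * d * (j + 2) ^ 2) =
        (n * d) * (4 * ((j + 2) * (2 : ℝ)⁻¹ ^ j)) ^ 2 by
          rw [show (4 : ℝ)⁻¹ = (2 : ℝ)⁻¹ ^ 2 by norm_num, pow_right_comm]; ring,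
        Real.sqrt_mul (by positivity), Real.sqrt_sq (by positivity)]
      ring
    rw [hsq] at hstep
    refine hstep.trans ((add_le_add_left (ih Q hQA hQ0 hQ) _).trans (le_of_eq ?_))
    push_cast
    ring

theorem width_restrict_le {X : Type*} {H : Set (X → ℤˣ)} (hH : H.Nonempty) {d : ℕ}
    (hd : ∀ S : Finset X, Shatters H S → #S ≤ d) {n : ℕ} (T : Fin n → X) :
    width (restrict H T) ≤ 24 * Real.sqrt (n * d) := by
  classical
  obtain ⟨A, hA⟩ : ∃ A : Finset (Labeling n), (A : Set (Labeling n)) = restrict H T :=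
    ⟨(restrict H T).toFinite.toFinset, by simp⟩
  have hA0 : A.Nonempty := by
    rw [← Finset.coe_nonempty, hA]
    obtain ⟨h, hh⟩ := hH
    exact ⟨_, h, hh, rfl⟩
  rw [← hA]
  rcases Nat.eq_zero_or_pos n with rfl | hn
  · have : Nonempty (A : Set (Labeling 0)) := hA0.to_subtype
    simp [width]
  rcases Nat.eq_zero_or_pos d with rfl | hd0
  · obtain ⟨p, hp⟩ := hA0
    have : A = {p} := by
      refine Finset.eq_singleton_iff_unique_mem.2 ⟨hp, fun q hq => ?_⟩
      obtain ⟨g, hg, rfl⟩ := hA.subset hq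
      obtain ⟨h, hh, rfl⟩ := hA.subset hp
      funext i
      by_contra hne
      have := hd {T i} fun y => ?_
      · simp at this
      · have : ∀ a b c : ℤˣ, a ≠ b → a = c ∨ b = c := by decide
        rcases this _ _ (y ⟨T i, by simp⟩) hne with h1 | h1
        · refine ⟨g, hg, ?_⟩
          rintro ⟨x, hx⟩
          obtain rfl := Finset.mem_singleton.1 hx
          exact h1
        · refine ⟨h, hh, ?_⟩
          rintro ⟨x, hx⟩
          obtain rfl := Finset.mem_singleton.1 hx
          exact h1
    rw [this]
    simp [width_singleton]
  have hn' : (0 : ℝ) < n := by exact_mod_cast hn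
  -- Below scale `1` all of `A` is separated, as distinct labelings are at distance at least `1`.
  obtain ⟨j, hj⟩ := exists_pow_lt_of_lt_one (show (0 : ℝ) < (n : ℝ)⁻¹ by positivity)
    (show (4 : ℝ)⁻¹ < 1 by norm_num)
  have hj' : (4 : ℝ)⁻¹ ^ j * n < 1 := by
    have := mul_lt_mul_of_pos_right hj hn'
    rwa [inv_mul_cancel₀ hn'.ne'] at this
  have := width_separated_le hd0 hd hn T hA.subset j A subset_rfl hA0 fun u _ v _ huv => by
    have : 1 ≤ hammingDist u v := hammingDist_pos.2 huv
    have : (1 : ℝ) ≤ hammingDist u v := by exact_mod_cast this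
    linarith
  refine this.trans ?_
  have h1 : 0 ≤ 4 * Real.sqrt (n * d) := by positivity
  have h2 : 0 ≤ (2 * (j : ℝ) + 6) * (2 : ℝ)⁻¹ ^ j := by positivity
  nlinarith

theorem card_le_toNat_vcDim {X : Type*} {H : Set (X → ℤˣ)} (hH : vcDim H ≠ ⊤) {S : Finset X}
    (hS : Shatters H S) : #S ≤ (vcDim H).toNat := by
  have h : (#S : ℕ∞) ≤ vcDim H := le_iSup₂ (f := fun (S : Finset X) (_ : Shatters H S) =>
    (#S : ℕ∞)) S hS
  rw [← ENat.natCast_toNat hH] at h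
  exact_mod_cast h

end AgnosticOIG

theorem mainTheorem4 {X : Type*} (H : Set (X → ℤˣ)) (hH : H.Nonempty) (n : ℕ) (T : Fin n → X) :
    AgnosticOIG.discountedDensity (AgnosticOIG.restrict H T) Finset.univ
        = (n : ℝ) / 2 * AgnosticOIG.rademacher (AgnosticOIG.restrict H T) ∧
      (AgnosticOIG.vcDim H ≠ ⊤ →
        AgnosticOIG.discountedDensity (AgnosticOIG.restrict H T) Finset.univ
          ≤ 16 * Real.sqrt ((n : ℝ) * ((AgnosticOIG.vcDim H).toNat : ℝ))) := by
  have hne : (AgnosticOIG.restrict H T).Nonempty := by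
    obtain ⟨h, hh⟩ := hH
    exact ⟨_, h, hh, rfl⟩
  rw [AgnosticOIG.discountedDensity_univ hne]
  refine ⟨(AgnosticOIG.mul_rademacher _ hne).symm, fun hvc => ?_⟩
  have h1 := AgnosticOIG.width_restrict_le hH
    (fun _ hS => AgnosticOIG.card_le_toNat_vcDim hvc hS) T
  have h2 := Real.sqrt_nonneg ((n : ℝ) * ((AgnosticOIG.vcDim H).toNat : ℝ))
  linarith
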